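/- Let $\mathcal C$ be a spherical fusion category over $\mathbb C$ with a pivotal structure (the right and the left duality $x\mapsto x^*$ agree as monoidal functors), in which every simple object is self-dual. Let $d(x)\in\mathbb C$ be the quantum dimension of $x$, i.e. the trace of $\mathrm{id}_x$; for each simple object $x$ fix a square root $\sqrt x$ of $d(x)$ and put $\sqrt{uv}=\sqrt u\sqrt v$. Assume that $\mathcal C$ is unitary: bases of all spaces $\mathrm{Hom}(u\otimes v,x)$ with $u,v,x$ simple (running over representatives of the isomorphism classes of simple objects) are given such that every associativity matrix $F^x_{uvw}$, defined by $$\beta\circ(\mathrm{id}_u\otimes\alpha)=\sum_{z,\gamma,\delta}(F^x_{uvw})^{y\alpha\beta}_{z\gamma\delta}\;\delta\circ(\gamma\otimes \mathrm{id}_w)$$ (associators suppressed; here $\alpha,\beta,\gamma,\delta$ are basis elements of $\mathrm{Hom}(v\otimes w,y)$, $\mathrm{Hom}(u\otimes y,x)$, $\mathrm{Hom}(u\otimes v,z)$, $\mathrm{Hom}(z\otimes w,x)$), is unitary. For a basis element $\alpha\in\mathrm{Hom}(u\otimes v,x)$ let $\bar\alpha\in\mathrm{Hom}(x,u\otimes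 v)$ be the algebraic dual basis element, normalized by $$\beta\circ\bar\alpha=\delta_{\alpha,\beta}\,\frac{\sqrt{uv}}{\sqrt x}\,\mathrm{id}_x .$$ Write $b_x:\mathbf 1\to x\otimes x^*$ and $\tilde d_x:x\otimes x^*\to\mathbf 1$ for the cup and the cap. For $\eta\in\mathrm{Hom}(g\otimes s,g')$ let $\bar\eta^{\,*}:s^*\otimes g^*\to g'^*$ be the dual of $\bar\eta:g'\to g\otimes s$ (with $(g\otimes s)^*=s^*\otimes g^*$), and consider the H-shaped diagram with left vertex $\eta$, right vertex $\bar\eta$ and horizontal edge $s$, $$H_{s,\eta}=(\eta\otimes\bar\eta^{\,*})\circ(\mathrm{id}_g\otimes b_s\otimes\mathrm{id}_{g^*})\;:\;g\otimes g^*\longrightarrow g'\otimes g'^* .$$ Then for all simple objects $g,g'$, $$\frac{\sqrt{g'}}{\sqrt g}\sum_{s,\eta}\sqrt s\;H_{s,\eta}\;=\;d(g')\;\, b_{g'}\circ\tilde d_g ,$$ where the sum runs over all simple objects $s$ (up to isomorphism) and all basis elements $\eta$ of $\mathrm{Hom}(g\otimes s,g')$. -/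

import Mathlib

open CategoryTheory MonoidalCategory

/-! Fusion categories over the complex numbers -/

section Fusion

variable {C : Type*} [Category C] [Preadditive C] [Linear ℂ C]

/-- `X` is simple: the map `ℂ → End X`, `c ↦ c • id`, is an isomorphism. -/
def IsSimpleObj (X : C) : Prop :=
  Function.Bijective (fun c : ℂ => c • 𝟙 X)

/-- `X` is a direct sum of finitely many simple objects. -/
def IsFiniteSumOfSimples (X : C) : Prop :=
  ∃ (n : ℕ) (Y : Fin n → C) (b : Limits.Bicone Y),
    (∀ i, IsSimpleObj (Y i)) ∧ Nonempty b.IsBilimit ∧ Nonempty (X ≅ b.pt)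

/-- `S` lists the simple objects: exactly one object out of each isomorphism class. -/
structure IsCompleteListOfSimples {ι : Type*} (S : ι → C) : Prop where
  simple : ∀ i, IsSimpleObj (S i)
  eq_of_iso : ∀ i j, Nonempty (S i ≅ S j) → i = j
  exists_iso : ∀ X : C, IsSimpleObj X → ∃ i, Nonempty (X ≅ S i)

variable (C) in
/-- A fusion category over `ℂ`, apart from rigidity, which is part of `PivotalCategory` below.
That the tensor product is bilinear is `MonoidalPreadditive` and `MonoidalLinear`. -/
class FusionCategory [MonoidalCategory C] [MonoidalPreadditive C] [MonoidalLinear ℂ C] :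
    Prop where
  /-- Every object is a direct sum of simple ones. -/
  semisimple : ∀ X : C, IsFiniteSumOfSimples X
  /-- Non-isomorphic simple objects are disjoint. -/
  schur : ∀ X Y : C, IsSimpleObj X → IsSimpleObj Y → ¬ Nonempty (X ≅ Y) →
    ∀ f : X ⟶ Y, f = 0
  /-- There are finitely many simple objects up to isomorphism. -/
  finite_simples : ∃ (n : ℕ) (S : Fin n → C), IsCompleteListOfSimples S
  finite_hom : ∀ X Y : C, FiniteDimensional ℂ (X ⟶ Y)
  unit_simple : IsSimpleObj (𝟙_ C)

end Fusion

/-! Duality, pivotal structures, traces -/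

section Pivotal

variable {C : Type*} [Category C] [MonoidalCategory C]

/-- The transpose of `f : X ⟶ Y` with respect to right duals `X'` of `X` and `Y'` of `Y`:
`(d_Y ⊗ id) ∘ (id ⊗ f ⊗ id) ∘ (id ⊗ b_X)`. -/
def rightTranspose {X Y : C} (X' Y' : C) [ExactPairing X X'] [ExactPairing Y Y']
    (f : X ⟶ Y) : Y' ⟶ X' :=
  (ρ_ Y').inv ≫ Y' ◁ η_ X X' ≫ Y' ◁ (f ▷ X') ≫ (α_ Y' Y X').inv ≫ ε_ Y Y' ▷ X' ≫ (λ_ X').hom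

/-- The transpose of `f : X ⟶ Y` with respect to left duals `X'` of `X` and `Y'` of `Y`. -/
def leftTranspose {X Y : C} (X' Y' : C) [ExactPairing X' X] [ExactPairing Y' Y]
    (f : X ⟶ Y) : Y' ⟶ X' :=
  (λ_ Y').inv ≫ η_ X' X ▷ Y' ≫ (X' ◁ f) ▷ Y' ≫ (α_ X' Y Y').hom ≫ X' ◁ ε_ Y' Y ≫ (ρ_ X').hom

variable (C) in
/-- Every object `X` has an object `dual X` that is a right dual and a left dual of `X`.
In a strict pivotal structure, where `X** = X`, the left duality between `dual X` and `X`
is the right duality of the object `dual X`. -/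
class TwoSidedDuals where
  dual : C → C
  right : ∀ X : C, ExactPairing X (dual X)
  left : ∀ X : C, ExactPairing (dual X) X

attribute [reducible, instance] TwoSidedDuals.right TwoSidedDuals.left

open TwoSidedDuals

variable (C) in
/-- A pivotal category: the right dual and the left dual are the same monoidal functor. -/
class PivotalCategory extends TwoSidedDuals C where
  /-- The two functors agree on morphisms. -/
  transpose_eq : ∀ {X Y : C} (f : X ⟶ Y),
    rightTranspose (dual X) (dual Y) f = leftTranspose (dual X) (dual Y) f
  /-- The two canonical isomorphisms `Y* ⊗ X* ≅ (X ⊗ Y)*`, one from the uniqueness of right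
  duals and one from the uniqueness of left duals, are equal. (If `(X ⊗ Y)* = Y* ⊗ X*` with
  the nested cups and caps, both are the identity.) -/
  tensor_eq : ∀ X Y : C,
    rightTranspose (dual (X ⊗ Y)) (dual Y ⊗ dual X) (𝟙 (X ⊗ Y)) =
      leftTranspose (dual (X ⊗ Y)) (dual Y ⊗ dual X) (𝟙 (X ⊗ Y))

/-- The cup `b_X : 𝟙 ⟶ X ⊗ X*`. -/
def cup [TwoSidedDuals C] (X : C) : 𝟙_ C ⟶ X ⊗ dual X := η_ X (dual X)

/-- The cap `X ⊗ X* ⟶ 𝟙`; it is `d_{X*}` if `X** = X`. -/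
def cap [TwoSidedDuals C] (X : C) : X ⊗ dual X ⟶ 𝟙_ C := ε_ (dual X) X

/-- The right trace. -/
def rightTrace [TwoSidedDuals C] {X : C} (f : X ⟶ X) : 𝟙_ C ⟶ 𝟙_ C :=
  cup X ≫ f ▷ dual X ≫ cap X

/-- The left trace. -/
def leftTrace [TwoSidedDuals C] {X : C} (f : X ⟶ X) : 𝟙_ C ⟶ 𝟙_ C :=
  η_ (dual X) X ≫ dual X ◁ f ≫ ε_ X (dual X)

variable (C) in
/-- A spherical category. -/
class SphericalCategory [PivotalCategory C] : Prop where
  trace_eq : ∀ {X : C} (f : X ⟶ X), rightTrace f = leftTrace f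

/-- For `η : g ⊗ s ⟶ g'` (the left vertex) and `ξ : g' ⟶ g ⊗ s`, whose transpose
`s* ⊗ g* ⟶ g'*` is the right vertex, the H-shaped diagram with horizontal edge `s`:
`(η ⊗ ξ*) ∘ (id ⊗ b_s ⊗ id) : g ⊗ g* ⟶ g' ⊗ g'*`. -/
def hDiagram [TwoSidedDuals C] {g s g' : C} (η : g ⊗ s ⟶ g') (ξ : g' ⟶ g ⊗ s) :
    g ⊗ dual g ⟶ g' ⊗ dual g' :=
  g ◁ (λ_ (dual g)).inv ≫ g ◁ (cup s ▷ dual g) ≫ g ◁ (α_ s (dual s) (dual g)).hom ≫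
    (α_ g s (dual s ⊗ dual g)).inv ≫
      (η ⊗ₘ rightTranspose (dual g') (dual s ⊗ dual g) ξ)

end Pivotal

/-! Quantum dimensions, trivalent bases, associativity matrices -/

section Trivalent

variable {C : Type*} [Category C] [Preadditive C] [Linear ℂ C]
  [MonoidalCategory C] [MonoidalPreadditive C] [MonoidalLinear ℂ C]

/-- The quantum dimension: the scalar by which the trace of the identity acts on the unit. -/
noncomputable def qdim [FusionCategory C] [TwoSidedDuals C] (X : C) : ℂ :=
  (Equiv.ofBijective _ (FusionCategory.unit_simple (C := C))).symm (rightTrace (𝟙 X))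

variable {ι : Type*}

/-- Labels for a basis of `Hom (u ⊗ v, x)`. -/
abbrev Mult (S : ι → C) (u v x : ι) : Type :=
  Fin (Module.finrank ℂ (S u ⊗ S v ⟶ S x))

/-- A choice of a basis of every space `Hom (u ⊗ v, x)` with `u`, `v`, `x` simple. -/
abbrev TrivalentBasis (S : ι → C) :=
  ∀ u v x : ι, Module.Basis (Mult S u v x) ℂ (S u ⊗ S v ⟶ S x)

/-- Labels `(y, α, β)` with `α : v ⊗ w ⟶ y` and `β : u ⊗ y ⟶ x`. -/
abbrev FCol (S : ι → C) (u v w x : ι) :=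
  Σ y : ι, Mult S v w y × Mult S u y x

/-- Labels `(z, γ, δ)` with `γ : u ⊗ v ⟶ z` and `δ : z ⊗ w ⟶ x`. -/
abbrev FRow (S : ι → C) (u v w x : ι) :=
  Σ z : ι, Mult S u v z × Mult S z w x

/-- `F` is the associativity matrix `F^x_{uvw}` in the basis `B`:
`β ∘ (id_u ⊗ α) = ∑ F^{yαβ}_{zγδ} δ ∘ (γ ⊗ id_w)`. -/
def IsFMatrix [Fintype ι] {S : ι → C} (B : TrivalentBasis S) (u v w x : ι)
    (F : Matrix (FRow S u v w x) (FCol S u v w x) ℂ) : Prop :=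
  ∀ c : FCol S u v w x,
    (α_ (S u) (S v) (S w)).hom ≫ S u ◁ (B v w c.1 c.2.1) ≫ B u c.1 x c.2.2 =
      ∑ a : FRow S u v w x, F a c • ((B u v a.1 a.2.1) ▷ S w ≫ B a.1 w x a.2.2)

/-- All associativity matrices are unitary in the basis `B`. -/
def IsUnitaryBasis [Fintype ι] [DecidableEq ι] {S : ι → C} (B : TrivalentBasis S) : Prop :=
  ∀ u v w x : ι, ∃ F : Matrix (FRow S u v w x) (FCol S u v w x) ℂ,
    IsFMatrix B u v w x F ∧ F * F.conjTranspose = 1 ∧ F.conjTranspose * F = 1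

/-- `Bbar` is the algebraic dual basis of `B`, where `r x` is the square root of the quantum
dimension of `x`: `β ∘ ᾱ = δ_{α,β} (√u √v / √x) id_x`. -/
def IsAlgebraicDual {S : ι → C} (B : TrivalentBasis S) (r : ι → ℂ)
    (Bbar : ∀ u v x : ι, Mult S u v x → (S x ⟶ S u ⊗ S v)) : Prop :=
  ∀ (u v x : ι) (a b : Mult S u v x),
    Bbar u v x a ≫ B u v x b = if a = b then (r u * r v / r x) • 𝟙 (S x) else 0

end Trivalent

/-!
The identity is the resolution of the identity of `g* ⊗ g'` through simple objects, turned by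
ninety degrees.

Bending the strand `g` turns `η : g ⊗ s ⟶ g'` into `φ : s ⟶ g* ⊗ g'`, and `η̄ : g' ⟶ g ⊗ s` into
`ψ : g* ⊗ g' ⟶ s`. Read sideways, `H_{s,η}` is the endomorphism `φ ∘ ψ` of `g* ⊗ g'`
(`hDiagram_eq_rotate`), and the identity of `g* ⊗ g'` becomes `b_{g'} ∘ d̃_g` (`rotate_id`). It
remains to show that the sum of all `√s φ ∘ ψ` is `√g √g'` times the identity
(`sum_leftComate_comp_leftMate`); multiplication by `√g' / √g` then gives the factor `d(g')`.

By semisimplicity this can be tested on morphisms from simple objects to `g* ⊗ g'`. The `φ` are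
bases of the spaces of such morphisms, so it suffices to compute the composites `ψ ∘ φ`. Between
different simple objects they vanish. On the same `s` the composite of `φ` and `ψ` for two basis
elements is a scalar, and it is the partial left trace over `g` of an endomorphism of `g ⊗ s`. Its
full trace equals, by cyclicity, that of `η ∘ η̄` on `g'`, which is known from the normalization of
the dual basis, and sphericality identifies the left trace of an identity with the quantum
dimension (`leftMate_comp_leftComate`). The scalar is thus `√g √g' / √s` on dual pairs and zero
otherwise. Division by the quantum dimensions is legitimate because those of simple objects do not
vanish (`qdim_ne_zero`).
-/

/-! ### Transposes and left traces -/

section Pairings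
open TwoSidedDuals

variable {C : Type*} [Category C] [MonoidalCategory C]

/-- A morphism slides around the cup of a left duality and becomes its left transpose. -/
lemma coevaluation_comp_whiskerLeft_eq_leftTranspose {X Y : C} (X' Y' : C) [ExactPairing X' X]
    [ExactPairing Y' Y] (f : X ⟶ Y) :
    η_ X' X ≫ X' ◁ f = η_ Y' Y ≫ leftTranspose X' Y' f ▷ Y := by
  symm
  calc
    _ = 𝟙 _ ⊗≫ (𝟙_ C ◁ η_ Y' Y ≫ η_ X' X ▷ (Y' ⊗ Y)) ⊗≫ X' ◁ f ▷ Y' ▷ Y ⊗≫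
        X' ◁ ε_ Y' Y ▷ Y ⊗≫ 𝟙 _ := by
      rw [leftTranspose]; monoidal
    _ = η_ X' X ⊗≫ X' ◁ (X ◁ η_ Y' Y ≫ f ▷ (Y' ⊗ Y)) ⊗≫ X' ◁ ε_ Y' Y ▷ Y ⊗≫ 𝟙 _ := by
      rw [whisker_exchange]; monoidal
    _ = η_ X' X ⊗≫ X' ◁ f ⊗≫ X' ◁ (Y ◁ η_ Y' Y ⊗≫ ε_ Y' Y ▷ Y) ⊗≫ 𝟙 _ := by
      rw [whisker_exchange]; monoidal
    _ = _ := by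
      rw [ExactPairing.coevaluation_evaluation'']; monoidal

/-- A morphism slides around the cap of a right duality and becomes its right transpose. -/
lemma whiskerLeft_comp_evaluation_eq_rightTranspose {X Y : C} (X' Y' : C) [ExactPairing X X']
    [ExactPairing Y Y'] (f : X ⟶ Y) :
    Y' ◁ f ≫ ε_ Y Y' = rightTranspose X' Y' f ▷ X ≫ ε_ X X' := by
  symm
  calc
    _ = 𝟙 _ ⊗≫ Y' ◁ η_ X X' ▷ X ⊗≫ Y' ◁ f ▷ X' ▷ X ⊗≫ (ε_ Y Y' ▷ (X' ⊗ X) ≫ 𝟙_ C ◁ ε_ X X') ⊗≫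
        𝟙 _ := by
      rw [rightTranspose]; monoidal
    _ = 𝟙 _ ⊗≫ Y' ◁ η_ X X' ▷ X ⊗≫ Y' ◁ (f ▷ (X' ⊗ X) ≫ Y ◁ ε_ X X') ⊗≫ ε_ Y Y' := by
      rw [← whisker_exchange]; monoidal
    _ = 𝟙 _ ⊗≫ Y' ◁ (η_ X X' ▷ X ⊗≫ X ◁ ε_ X X') ⊗≫ Y' ◁ f ⊗≫ ε_ Y Y' := by
      rw [← whisker_exchange]; monoidal
    _ = _ := by
      rw [ExactPairing.evaluation_coevaluation'']; monoidal

/-- The left trace of `f : X ⟶ X` computed with an object `X'` that is both a right and a left dual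
of `X`, not necessarily the chosen dual `dual X`. -/
def leftTraceWith {X : C} (X' : C) [ExactPairing X X'] [ExactPairing X' X] (f : X ⟶ X) :
    𝟙_ C ⟶ 𝟙_ C :=
  η_ X' X ≫ X' ◁ f ≫ ε_ X X'

/-- Cyclicity of the trace: `f` is moved around the loop. The passage through the cup turns it into
its left transpose and the passage through the cap into its right transpose, so these two have to
agree. -/
lemma leftTraceWith_comp_comm {X Y : C} (X' Y' : C) [ExactPairing X X'] [ExactPairing X' X]
    [ExactPairing Y Y'] [ExactPairing Y' Y] (f : X ⟶ Y) (g : Y ⟶ X)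
    (hf : rightTranspose X' Y' f = leftTranspose X' Y' f) :
    leftTraceWith X' (f ≫ g) = leftTraceWith Y' (g ≫ f) := by
  calc
    _ = (η_ X' X ≫ X' ◁ f) ≫ X' ◁ g ≫ ε_ X X' := by simp [leftTraceWith]
    _ = η_ Y' Y ≫ Y' ◁ g ≫ leftTranspose X' Y' f ▷ X ≫ ε_ X X' := by
      rw [coevaluation_comp_whiskerLeft_eq_leftTranspose X' Y', Category.assoc,
        whisker_exchange_assoc]
    _ = _ := by
      rw [← hf, ← whiskerLeft_comp_evaluation_eq_rightTranspose]; simp [leftTraceWith]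

lemma leftTrace_comp_comm [PivotalCategory C] {X Y : C} (f : X ⟶ Y) (g : Y ⟶ X) :
    leftTrace (f ≫ g) = leftTrace (g ≫ f) :=
  leftTraceWith_comp_comm (dual X) (dual Y) f g (PivotalCategory.transpose_eq f)

/-- The left trace on `X ⊗ Y` may be computed with nested cups and caps. This is
`leftTraceWith_comp_comm` for the identity of `X ⊗ Y`, seen as a morphism between two copies of
`X ⊗ Y` with different duals; the pivotal axiom on tensor products supplies its hypothesis. -/
lemma leftTrace_tensor [PivotalCategory C] {X Y : C} (f : X ⊗ Y ⟶ X ⊗ Y) :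
    leftTraceWith (dual Y ⊗ dual X) f = leftTrace f := by
  have := leftTraceWith_comp_comm (dual (X ⊗ Y)) (dual Y ⊗ dual X) (𝟙 (X ⊗ Y)) f
    (PivotalCategory.tensor_eq X Y)
  rw [Category.id_comp, Category.comp_id] at this
  exact this.symm

/-! ### Mates and the H-diagram -/

/-- The mate `Y ⟶ X' ⊗ Z` of `f : X ⊗ Y ⟶ Z`, where the strand `X` is bent upwards by the cup
`𝟙 ⟶ X' ⊗ X`. -/
def leftMate {X Y Z : C} (X' : C) [ExactPairing X' X] (f : X ⊗ Y ⟶ Z) : Y ⟶ X' ⊗ Z :=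
  tensorLeftHomEquiv Y X' X Z f

/-- The mate `X' ⊗ Z ⟶ Y` of `f : Z ⟶ X ⊗ Y`, where the strand `X` is bent downwards by the cap
`X' ⊗ X ⟶ 𝟙`. -/
def leftComate {X Y Z : C} (X' : C) [ExactPairing X X'] (f : Z ⟶ X ⊗ Y) : X' ⊗ Z ⟶ Y :=
  (tensorLeftHomEquiv Z X X' Y).symm f

/-- The composite of the two mates is the partial left trace of `f ≫ h` over `X`, so closing the
strand `Y` gives the full left trace. -/
lemma leftTraceWith_mate_comp {X Y Z : C} (X' Y' : C) [ExactPairing X X'] [ExactPairing X' X]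
    [ExactPairing Y Y'] [ExactPairing Y' Y] (f : X ⊗ Y ⟶ Z) (h : Z ⟶ X ⊗ Y) :
    leftTraceWith Y' (leftMate X' f ≫ leftComate X' h) = leftTraceWith (Y' ⊗ X') (f ≫ h) := by
  simp only [leftTraceWith, leftMate, leftComate, tensorLeftHomEquiv, Equiv.coe_fn_mk,
    Equiv.coe_fn_symm_mk, ExactPairing.tensor_coevaluation, ExactPairing.tensor_evaluation]
  monoidal

/-- Rotation of `h : X* ⊗ Y ⟶ X* ⊗ Y` by a quarter turn: the incoming strand `Y` is bent by the cup
of `Y`, the outgoing strand `X*` by the cap of `X`. -/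
def rotate {X Y : C} [TwoSidedDuals C] (h : dual X ⊗ Y ⟶ dual X ⊗ Y) :
    X ⊗ dual X ⟶ Y ⊗ dual Y :=
  𝟙 _ ⊗≫ (X ⊗ dual X) ◁ cup Y ⊗≫ X ◁ h ▷ dual Y ⊗≫ cap X ▷ (Y ⊗ dual Y) ⊗≫ 𝟙 _

lemma rotate_id [TwoSidedDuals C] (X Y : C) :
    rotate (𝟙 (dual X ⊗ Y)) = cap X ≫ cup Y := by
  calc
    _ = 𝟙 _ ⊗≫ ((X ⊗ dual X) ◁ cup Y ≫ cap X ▷ (Y ⊗ dual Y)) ⊗≫ 𝟙 _ := by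
      rw [rotate]; monoidal
    _ = _ := by rw [whisker_exchange]; monoidal

lemma tensorLeftHomEquiv_symm_apply {X Y Y' Z : C} [ExactPairing Y Y'] (f : X ⟶ Y ⊗ Z) :
    (tensorLeftHomEquiv X Y Y' Z).symm f = Y' ◁ f ⊗≫ ε_ Y Y' ▷ Z ⊗≫ 𝟙 _ := by
  simp only [tensorLeftHomEquiv, Equiv.coe_fn_symm_mk]; monoidal

/-- Seen sideways, the H-diagram with horizontal edge `s` is an endomorphism of `g* ⊗ g'` that
factors through `s`. -/
lemma hDiagram_eq_rotate [TwoSidedDuals C] {g s g' : C} (η : g ⊗ s ⟶ g') (ξ : g' ⟶ g ⊗ s) :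
    hDiagram η ξ = rotate (leftComate (dual g) ξ ≫ leftMate (dual g) η) := by
  have hη : g ◁ leftMate (dual g) η ⊗≫ cap g ▷ g' ⊗≫ 𝟙 _ = η := by
    rw [cap, ← tensorLeftHomEquiv_symm_apply, leftMate, Equiv.symm_apply_apply]
  -- `ψ` is the right vertex with the cup `b_s` pulled straight.
  let ψ : dual g ⟶ s ⊗ dual g' := 𝟙 _ ⊗≫ dual g ◁ cup g' ⊗≫ leftComate (dual g) ξ ▷ dual g'
  have hξ : cup s ▷ dual g ⊗≫ s ◁ rightTranspose (dual g') (dual s ⊗ dual g) ξ = 𝟙 _ ⊗≫ ψ := by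
    calc
      _ = 𝟙 _ ⊗≫ (cup s ▷ dual g ≫ (s ⊗ dual s) ◁ ψ) ⊗≫ s ◁ ε_ s (dual s) ▷ dual g' ⊗≫ 𝟙 _ := by
        simp only [ψ]
        rw [leftComate, tensorLeftHomEquiv_symm_apply, rightTranspose, cup, cup,
          ExactPairing.tensor_evaluation]
        monoidal
      _ = 𝟙 _ ⊗≫ ψ ⊗≫ (η_ s (dual s) ▷ s ⊗≫ s ◁ ε_ s (dual s)) ▷ dual g' ⊗≫ 𝟙 _ := by
        rw [← whisker_exchange, cup]; monoidal
      _ = 𝟙 _ ⊗≫ ψ := by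
        rw [ExactPairing.evaluation_coevaluation'']; monoidal
  calc
    _ = g ◁ (λ_ (dual g)).inv ⊗≫ g ◁ (cup s ▷ dual g ⊗≫
          s ◁ rightTranspose (dual g') (dual s ⊗ dual g) ξ) ⊗≫ η ▷ dual g' := by
      rw [hDiagram, tensorHom_def']; monoidal
    _ = g ◁ (λ_ (dual g)).inv ⊗≫ g ◁ (𝟙 _ ⊗≫ ψ) ⊗≫
          (g ◁ leftMate (dual g) η ⊗≫ cap g ▷ g' ⊗≫ 𝟙 _) ▷ dual g' := by
      rw [hξ, hη]
    _ = _ := by simp only [ψ]; rw [rotate]; monoidal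

end Pairings

/-! ### Simple objects and quantum dimensions -/

section Linear
open TwoSidedDuals

variable {C : Type*} [Category C] [Preadditive C] [Linear ℂ C]

lemma IsSimpleObj.exists_smul_id {X : C} (hX : IsSimpleObj X) (f : X ⟶ X) :
    ∃ c : ℂ, f = c • 𝟙 X :=
  let ⟨c, hc⟩ := hX.2 f
  ⟨c, hc.symm⟩

lemma IsSimpleObj.smul_id_injective {X : C} (hX : IsSimpleObj X) {c d : ℂ}
    (h : c • 𝟙 X = d • 𝟙 X) : c = d :=
  hX.1 h

lemma IsSimpleObj.id_ne_zero {X : C} (hX : IsSimpleObj X) : 𝟙 X ≠ 0 := fun h =>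
  one_ne_zero (hX.smul_id_injective (c := 1) (d := 0) (by simp [h]))

variable [MonoidalCategory C] [MonoidalPreadditive C]

lemma cup_ne_zero [TwoSidedDuals C] {X : C} (hX : IsSimpleObj X) : cup X ≠ 0 := by
  intro h
  have := ExactPairing.evaluation_coevaluation X (dual X)
  rw [← cup, h] at this
  apply hX.id_ne_zero
  rw [← cancel_epi (λ_ X).hom, ← cancel_mono (ρ_ X).inv]
  simpa using this.symm

variable [MonoidalLinear ℂ C]

lemma hom_ext_from_simple [FusionCategory C] {X Z : C} {f g : X ⟶ Z}
    (h : ∀ (Y : C), IsSimpleObj Y → ∀ u : Y ⟶ X, u ≫ f = u ≫ g) : f = g := by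
  obtain ⟨n, Y, b, hY, ⟨hb⟩, ⟨i⟩⟩ := FusionCategory.semisimple X
  have : i.inv ≫ f = i.inv ≫ g :=
    hb.isColimit.hom_ext fun ⟨j⟩ => by
      simpa using h (Y j) (hY j) (b.ι j ≫ i.inv)
  simpa using this

lemma hom_ext_to_simple [FusionCategory C] {X Z : C} {f g : Z ⟶ X}
    (h : ∀ (Y : C), IsSimpleObj Y → ∀ u : X ⟶ Y, f ≫ u = g ≫ u) : f = g := by
  obtain ⟨n, Y, b, hY, ⟨hb⟩, ⟨i⟩⟩ := FusionCategory.semisimple X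
  have : f ≫ i.hom = g ≫ i.hom :=
    hb.isLimit.hom_ext fun ⟨j⟩ => by
      simpa using h (Y j) (hY j) (i.hom ≫ b.π j)
  simpa using this

lemma exists_eq_smul_cap [TwoSidedDuals C] {X : C} (hX : IsSimpleObj X)
    (f : X ⊗ dual X ⟶ 𝟙_ C) : ∃ c : ℂ, f = c • cap X := by
  obtain ⟨c, hc⟩ := hX.exists_smul_id
    (tensorRightHomEquiv X (dual X) X (𝟙_ C) f ≫ (λ_ X).hom)
  refine ⟨c, ?_⟩
  have h1 : tensorRightHomEquiv X (dual X) X (𝟙_ C) f = c • (λ_ X).inv := by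
    rw [← cancel_mono (λ_ X).hom, hc]; simp
  rw [← Equiv.symm_apply_apply (tensorRightHomEquiv X (dual X) X (𝟙_ C)) f, h1]
  simp [tensorRightHomEquiv, cap, ← unitors_equal]

lemma rightTrace_id_eq [FusionCategory C] [TwoSidedDuals C] (X : C) :
    rightTrace (𝟙 X) = qdim X • 𝟙 (𝟙_ C) :=
  ((Equiv.ofBijective _ (FusionCategory.unit_simple (C := C))).apply_symm_apply
    (rightTrace (𝟙 X))).symm

/-- The unit occurs exactly once in `X ⊗ X*`: every morphism `X ⊗ X* ⟶ 𝟙` is a multiple of the cap.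
If the cup composed with the cap were zero, the cup would be killed by every morphism to a simple
object, and would vanish. -/
lemma qdim_ne_zero [FusionCategory C] [TwoSidedDuals C] {X : C} (hX : IsSimpleObj X) :
    qdim X ≠ 0 := by
  intro h
  have h0 : cup X ≫ cap X = 0 := by
    simpa [h, rightTrace] using rightTrace_id_eq X
  have h1 : ∀ f : X ⊗ dual X ⟶ 𝟙_ C, cup X ≫ f = 0 := fun f => by
    obtain ⟨c, rfl⟩ := exists_eq_smul_cap hX f
    simp [h0]
  refine cup_ne_zero hX (hom_ext_to_simple fun Y hY u => ?_)
  rw [Limits.zero_comp]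
  by_cases hi : Nonempty (𝟙_ C ≅ Y)
  · obtain ⟨i⟩ := hi
    rw [← cancel_mono i.inv, Category.assoc, h1, Limits.zero_comp]
  · exact FusionCategory.schur _ _ FusionCategory.unit_simple hY hi _

lemma leftTrace_smul_id [FusionCategory C] [PivotalCategory C] [SphericalCategory C] (X : C)
    (c : ℂ) : leftTrace (c • 𝟙 X) = (c * qdim X) • 𝟙 (𝟙_ C) := by
  rw [mul_smul, ← rightTrace_id_eq, SphericalCategory.trace_eq]
  simp [leftTrace]

/-! ### Dual bases of mates -/

/-- `leftMate` as a linear equivalence. -/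
def leftMateLinearEquiv (X Y Z X' : C) [ExactPairing X' X] : (X ⊗ Y ⟶ Z) ≃ₗ[ℂ] (Y ⟶ X' ⊗ Z) :=
  { tensorLeftHomEquiv Y X' X Z with
    toFun := leftMate X'
    map_add' := fun f g => by simp [leftMate, tensorLeftHomEquiv]
    map_smul' := fun c f => by simp [leftMate, tensorLeftHomEquiv] }

/-- `rotate` as a linear map. -/
def rotateLinearMap [TwoSidedDuals C] (X Y : C) :
    (dual X ⊗ Y ⟶ dual X ⊗ Y) →ₗ[ℂ] (X ⊗ dual X ⟶ Y ⊗ dual Y) where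
  toFun := rotate
  map_add' f g := by simp [rotate, monoidalComp]
  map_smul' c f := by simp [rotate, monoidalComp]

lemma rotateLinearMap_apply [TwoSidedDuals C] (X Y : C) (h : dual X ⊗ Y ⟶ dual X ⊗ Y) :
    rotateLinearMap X Y h = rotate h :=
  rfl

/-- If `h ≫ f` is a scalar, the composite of the mates of `f` and `h` is a scalar as well, and
comparing left traces, by cyclicity, determines it. -/
lemma leftMate_comp_leftComate [FusionCategory C] [PivotalCategory C] [SphericalCategory C]
    {X Y Z : C} (hY : IsSimpleObj Y) (f : X ⊗ Y ⟶ Z) (h : Z ⟶ X ⊗ Y) {c : ℂ}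
    (hc : h ≫ f = c • 𝟙 Z) :
    leftMate (dual X) f ≫ leftComate (dual X) h = (c * qdim Z / qdim Y) • 𝟙 Y := by
  obtain ⟨k, hk⟩ := hY.exists_smul_id (leftMate (dual X) f ≫ leftComate (dual X) h)
  have h1 : leftTrace (leftMate (dual X) f ≫ leftComate (dual X) h) = leftTrace (c • 𝟙 Z) := by
    rw [← hc, leftTrace_comp_comm h f, ← leftTrace_tensor]
    exact leftTraceWith_mate_comp (dual X) (dual Y) f h
  rw [hk, leftTrace_smul_id, leftTrace_smul_id] at h1
  rw [hk, ← FusionCategory.unit_simple.smul_id_injective h1,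
    mul_div_cancel_right₀ _ (qdim_ne_zero hY)]

/-- Resolution of the identity of `g* ⊗ g'` through simple objects: the mates of the trivalent basis
form bases of all spaces `Hom(s, g* ⊗ g')`, and the mates of the algebraic dual basis are dual to
them up to the scalar `√g √g' / √s`. -/
lemma sum_leftComate_comp_leftMate [FusionCategory C] [PivotalCategory C] [SphericalCategory C]
    {ι : Type*} [Fintype ι] [DecidableEq ι] {S : ι → C} (hS : IsCompleteListOfSimples S)
    (B : TrivalentBasis S) (r : ι → ℂ) (hr : ∀ x, r x ^ 2 = qdim (S x))
    (Bbar : ∀ u v x : ι, Mult S u v x → (S x ⟶ S u ⊗ S v)) (hBbar : IsAlgebraicDual B r Bbar)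
    (g g' : ι) :
    ∑ s : ι, ∑ a : Mult S g s g', r s •
      (leftComate (dual (S g)) (Bbar g s g' a) ≫ leftMate (dual (S g)) (B g s g' a)) =
    (r g * r g') • 𝟙 (dual (S g) ⊗ S g') := by
  have hr0 (x : ι) : r x ≠ 0 := fun h => qdim_ne_zero (hS.simple x) (by rw [← hr, h]; simp)
  have orth (t s : ι) (b : Mult S g t g') (a : Mult S g s g') (hst : s ≠ t) :
      leftMate (dual (S g)) (B g t g' b) ≫ leftComate (dual (S g)) (Bbar g s g' a) = 0 :=
    FusionCategory.schur _ _ (hS.simple t) (hS.simple s)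
      (fun h => hst (hS.eq_of_iso _ _ h).symm) _
  -- the scalar is `(√g √t / √g') * d(g') / d(t)`, with `d(x) = √x ^ 2`
  have dualpair (t : ι) (b a : Mult S g t g') :
      leftMate (dual (S g)) (B g t g' b) ≫ leftComate (dual (S g)) (Bbar g t g' a) =
        if a = b then (r g * r g' / r t) • 𝟙 (S t) else 0 := by
    have := hBbar g t g' a b
    rw [leftMate_comp_leftComate (hS.simple t) (c := if a = b then r g * r t / r g' else 0)]
    · split_ifs
      · congr 1
        rw [← hr, ← hr]
        field_simp [hr0]
      · simp
    · rw [this]; split_ifs <;> simp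
  refine hom_ext_from_simple fun Y hY u => ?_
  obtain ⟨t, ⟨i⟩⟩ := hS.exists_iso Y hY
  rw [← cancel_epi i.inv, ← Category.assoc, ← Category.assoc]
  generalize i.inv ≫ u = v
  let b := (B g t g').map (leftMateLinearEquiv (S g) (S t) (S g') (dual (S g)))
  have hb (a) : b a = leftMate (dual (S g)) (B g t g' a) := by
    simp only [b, Module.Basis.map_apply]; rfl
  suffices Linear.rightComp ℂ (S t) (∑ s : ι, ∑ a : Mult S g s g', r s •
      (leftComate (dual (S g)) (Bbar g s g' a) ≫ leftMate (dual (S g)) (B g s g' a))) =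
      Linear.rightComp ℂ (S t) ((r g * r g') • 𝟙 (dual (S g) ⊗ S g')) from
    LinearMap.congr_fun this v
  refine b.ext fun a => ?_
  simp only [hb, Linear.rightComp_apply, Preadditive.comp_sum, Linear.comp_smul]
  rw [Finset.sum_eq_single t, Finset.sum_eq_single a]
  · rw [← Category.assoc, dualpair, if_pos rfl, Linear.smul_comp, smul_smul, Category.id_comp,
      Category.comp_id, mul_div_cancel₀ _ (hr0 t)]
  · intro a' _ ha
    rw [← Category.assoc, dualpair, if_neg ha, Limits.zero_comp, smul_zero]
  · simp
  · intro s _ hs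
    refine Finset.sum_eq_zero fun a' _ => ?_
    rw [← Category.assoc, orth t s a a' hs, Limits.zero_comp, smul_zero]
  · simp

end Linear

/-! ### Summing the H-diagrams -/

theorem mainTheorem4 {C : Type*} [Category C] [Preadditive C] [Linear ℂ C]
    [MonoidalCategory C] [MonoidalPreadditive C] [MonoidalLinear ℂ C]
    [FusionCategory C] [PivotalCategory C] [SphericalCategory C]
    (hdual : ∀ X : C, IsSimpleObj X → Nonempty (X ≅ TwoSidedDuals.dual X))
    {ι : Type*} [Fintype ι] [DecidableEq ι] (S : ι → C) (hS : IsCompleteListOfSimples S)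
    (B : TrivalentBasis S) (hB : IsUnitaryBasis B)
    (r : ι → ℂ) (hr : ∀ x, r x ^ 2 = qdim (S x))
    (Bbar : ∀ u v x : ι, Mult S u v x → (S x ⟶ S u ⊗ S v)) (hBbar : IsAlgebraicDual B r Bbar)
    (g g' : ι) :
    (r g' / r g) • ∑ s : ι, ∑ a : Mult S g s g',
        r s • hDiagram (B g s g' a) (Bbar g s g' a) =
      qdim (S g') • (cap (S g) ≫ cup (S g')) := by
  have hg : r g ≠ 0 := fun h => qdim_ne_zero (hS.simple g) (by rw [← hr, h]; simp)
  have h := congrArg (rotateLinearMap (S g) (S g'))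
    (sum_leftComate_comp_leftMate hS B r hr Bbar hBbar g g')
  simp only [map_sum, map_smul, rotateLinearMap_apply, ← hDiagram_eq_rotate, rotate_id] at h
  rw [h, smul_smul, ← hr]
  congr 1
  field_simp
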